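/- Let $\Omega=\{(b,d)\in\mathbb R^2 : b<d\}$, $\overline\Omega=\{b\le d\}$, $\partial\Omega=\{b=d\}$, and let $d(\cdot,\cdot)$ be the Euclidean distance. For $p\ge 1$ let $\mathcal M^p(\Omega)$ be the set of non-negative Borel measures $\mu$ supported on $\Omega$, finite on the compact subsets of $\Omega$, with finite $p$-persistence $\mathrm{Pers}_p(\mu)=\big(\int_\Omega d(x,\partial\Omega)^p\,d\mu(x)\big)^{1/p}<\infty$. For Borel measures $\mu,\nu$ on $\Omega$, let $\mathrm{Adm}(\mu,\nu)$ be the set of Borel measures $\gamma$ on $\overline\Omega\times\overline\Omega$ that are finite on the compact subsets of $(\overline\Omega\times\overline\Omega)\setminus(\partial\Omega\times\partial\Omega)$ and satisfy $\gamma(A\times\overline\Omega)=\mu(A)$ and $\gamma(\overline\Omega\times B)=\nu(B)$ for all Borel sets $A,B\subset\Omega$, and put $$\mathrm{FG}_p(\mu,\nu)=\Big(\inf_{\gamma\in\mathrm{Adm}(\mu,\nu)}\iint d(x,y)^p\,d\gamma(x,y)\Big)^{1/p}\in[0,\infty].$$ For $t\in\mathbb R$ let $\pi_t(z)=(t,t)+\frac{z_2-z_1}{2}(-1,1)$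 if $z_1\le t\le z_2$, and let $\pi_t(z)$ be the diagonal point $(t,t)$ otherwise. For $\mu\in\mathcal M^p(\Omega)$ let $d\tilde\mu(x)=d(x,\partial\Omega)^{-1}\,d\mu(x)$, and let $\pi_t\#\tilde\mu$ denote the restriction to $\Omega$ of the pushforward of $\tilde\mu$ by $\pi_t$. The Sliced Figalli--Gigli distance is $$\mathrm{SFG}_p(\mu,\nu)=\frac1{\sqrt2}\Big(\int_{\mathbb R}\mathrm{FG}_p^p(\pi_t\#\tilde\mu,\pi_t\#\tilde\nu)\,dt\Big)^{1/p}.$$ **Proposition.** Let $1\le p\le 2$. 1. $\mathrm{SFG}_p$ is well defined on $\mathcal M^p(\Omega)$: for all $\mu,\nu\in\mathcal M^p(\Omega)$ the function $t\mapsto \mathrm{FG}_p^p(\pi_t\#\tilde\mu,\pi_t\#\tilde\nu)$ is Lebesgue measurable and $\mathrm{SFG}_p(\mu,\nu)<\infty$. 2. $\mathrm{SFG}_p^p$ is conditionally negative definite on $\mathcal M^p(\Omega)$: for all $n$, all $\mu_1,\dots,\mu_n\in\mathcal M^p(\Omega)$ and all $a_1,\dots,a_n\in\mathbb R$ with $\sum_i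 a_i=0$, one has $\sum_{i,j}a_ia_j\,\mathrm{SFG}_p^p(\mu_i,\mu_j)\le 0$. 3. Consequently, for every $\sigma>0$, $k(\mu,\nu)=\exp\!\big(-\mathrm{SFG}_p^p(\mu,\nu)/\sigma^2\big)$ is a positive semi-definite kernel on $\mathcal M^p(\Omega)$: it is symmetric, and for all $\mu_1,\dots,\mu_n\in\mathcal M^p(\Omega)$ the matrix $(k(\mu_i,\mu_j))_{i,j}$ is positive semi-definite. -/

import Mathlib

open MeasureTheory
open scoped ENNReal

namespace Persistence

/-- The plane with its Euclidean metric. -/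
abbrev Plane := EuclideanSpace ℝ (Fin 2)

/-- The open half-plane of points `(b, d)` with `b < d`. -/
def Omega : Set Plane := {z | z 0 < z 1}

/-- The closed half-plane. -/
def OmegaBar : Set Plane := {z | z 0 ≤ z 1}

/-- The diagonal, that is, the boundary of the half-plane. -/
def Diagonal : Set Plane := {z | z 0 = z 1}

/-- Euclidean distance of a point to the diagonal. -/
noncomputable def distDiag (z : Plane) : ℝ≥0∞ := Metric.infEDist z Diagonal

/-- Radon measures supported on the open half-plane: Borel measures carried by it that are finite
on its compact subsets. -/
def IsRadonOnOmega (μ : Measure Plane) : Prop :=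
  μ Omegaᶜ = 0 ∧ ∀ K : Set Plane, K ⊆ Omega → IsCompact K → μ K < ∞

/-- The `p`-persistence of a measure, as an extended nonnegative number. -/
noncomputable def Pers (p : ℝ) (μ : Measure Plane) : ℝ≥0∞ :=
  (∫⁻ z in Omega, distDiag z ^ p ∂μ) ^ (1 / p)

/-- The space of persistence measures: Radon measures of finite `p`-persistence. -/
def PersMeasures (p : ℝ) : Set (Measure Plane) :=
  {μ | IsRadonOnOmega μ ∧ Pers p μ < ∞}

/-- Admissible transport plans. Only the marginals on the open half-plane are prescribed, so any
amount of mass may be sent to or taken from the diagonal. Plans are Radon away from pairs of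
diagonal points; the mass between diagonal points is not constrained. -/
def Adm (μ ν : Measure Plane) : Set (Measure (Plane × Plane)) :=
  {γ | γ (OmegaBar ×ˢ OmegaBar)ᶜ = 0 ∧
    (∀ K : Set (Plane × Plane), K ⊆ (OmegaBar ×ˢ OmegaBar) \ (Diagonal ×ˢ Diagonal) →
      IsCompact K → γ K < ∞) ∧
    (∀ A : Set Plane, A ⊆ Omega → MeasurableSet A → γ (A ×ˢ OmegaBar) = μ A) ∧
    (∀ B : Set Plane, B ⊆ Omega → MeasurableSet B → γ (OmegaBar ×ˢ B) = ν B)}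

/-- The Figalli-Gigli distance. -/
noncomputable def FG (p : ℝ) (μ ν : Measure Plane) : ℝ≥0∞ :=
  (⨅ γ ∈ Adm μ ν, ∫⁻ z, edist z.1 z.2 ^ p ∂γ) ^ (1 / p)

/-- The projection onto the geodesic `{(t, t) + s (-1, 1) : s > 0}` issued from the diagonal.
Points outside the region `z 0 ≤ t ≤ z 1` are projected to the diagonal, all of whose points are
identified; it is represented by its point `(t, t)`. -/
noncomputable def proj (t : ℝ) (z : Plane) : Plane :=
  open Classical in
  if z 0 ≤ t ∧ t ≤ z 1 then !₂[t - (z 1 - z 0) / 2, t + (z 1 - z 0) / 2] else !₂[t, t]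

theorem measurable_proj (t : ℝ) : Measurable (proj t) := by
  have h0 : Measurable fun z : Plane => z 0 := (PiLp.continuous_apply 2 _ 0).measurable
  have h1 : Measurable fun z : Plane => z 1 := (PiLp.continuous_apply 2 _ 1).measurable
  unfold proj
  refine Measurable.ite ?_ ?_ measurable_const
  · exact (measurableSet_le h0 measurable_const).inter (measurableSet_le measurable_const h1)
  · refine Continuous.measurable ?_
    refine (PiLp.continuous_toLp 2 _).comp (continuous_pi fun i => ?_)
    fin_cases i <;> simp <;> fun_prop

/-- The normalized measure, of density `1 / d(z, diagonal)` with respect to `μ`. -/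
noncomputable def normalized (μ : Measure Plane) : Measure Plane :=
  μ.withDensity fun z => (distDiag z)⁻¹

/-- The pushforward of the normalized measure by the projection with parameter `t`, restricted to
the geodesic without its diagonal point. -/
noncomputable def slice (t : ℝ) (μ : Measure Plane) : Measure Plane :=
  ((normalized μ).map (proj t)).restrict Omega

/-- The sliced Figalli-Gigli distance, as an extended nonnegative number. -/
noncomputable def SFG (p : ℝ) (μ ν : Measure Plane) : ℝ≥0∞ :=
  ENNReal.ofReal (1 / √2) * (∫⁻ t : ℝ, FG p (slice t μ) (slice t ν) ^ p) ^ (1 / p)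

/-- The real-valued function `SFG_p ^ p` on the space of persistence measures. -/
noncomputable def sfgPow (p : ℝ) (μ ν : PersMeasures p) : ℝ :=
  (SFG p (μ : Measure Plane) (ν : Measure Plane)).toReal ^ p

/-- Conditionally negative definite functions. -/
def IsCND {X : Type*} (f : X → X → ℝ) : Prop :=
  ∀ (n : ℕ) (x : Fin n → X) (a : Fin n → ℝ), ∑ i, a i = 0 →
    ∑ i, ∑ j, a i * a j * f (x i) (x j) ≤ 0

/-- Positive semi-definite kernels. -/
def IsPSDKernel {X : Type*} (k : X → X → ℝ) : Prop :=
  (∀ x y, k x y = k y x) ∧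
    ∀ (n : ℕ) (x : Fin n → X), (Matrix.of fun i j => k (x i) (x j)).PosSemidef

end Persistence

namespace Persistence

/-! Each slice lives on a single ray, where optimal transport is explicit. Describe a measure on the
ray by its quantile function counted from above, so that level `u` carries the point exceeded by
mass `u`. Past the total mass the quantile is `0`, the diagonal point, so the diagonal is a
reservoir built into the description and measures of different, even infinite, mass can be compared
level by level.

For `1 ≤ p` this monotone coupling is optimal (`lintegral_quantile_le`). The convex cost is a
superposition of indicators of `{f ≤ a, a + r < g}`; the tails alone force a lower bound on the mass
of each such set, and the quantile coupling meets it. Heights are 1-Lipschitz on the plane and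
isometric on rays, so `FG_p ^ p` of two slices is the `L^p` distance of their quantiles, to the
power `p` (`FG_rpow_map_rayPoint`).

Tonelli over the slices turns the `p`-th moments into `√2` times the integral of the `p`-th power of
the distance to the diagonal (`lintegral_lintegral_sliceHeights`). So almost every slice has finite
tails, and `μ ↦ sliceQuantile μ` maps persistence measures into `L^p(levelMeasure)`, with `SFG_p ^
p` equal to `(1 / √2) ^ p` times the `p`-th power of the distance (`sfgPow_eq`). This gives
measurability and finiteness. Negative definiteness integrates that of `|x - y| ^ p` on the line,
valid for `0 < p ≤ 2`, and Schoenberg's theorem gives the kernel. -/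

/-! ### Negative definiteness of `|x - y| ^ p` on the line -/

theorem sum_mul_cos_sub {n : ℕ} (a x : Fin n → ℝ) :
    ∑ i, ∑ j, a i * a j * Real.cos (x i - x j) =
      (∑ i, a i * Real.cos (x i)) ^ 2 + (∑ i, a i * Real.sin (x i)) ^ 2 := by
  simp_rw [sq, Finset.sum_mul_sum, ← Finset.sum_add_distrib, Real.cos_sub]
  exact Finset.sum_congr rfl fun i _ => Finset.sum_congr rfl fun j _ => by ring

/-- Near `0` the quadratic bound on `1 - cos` leaves `s ^ (1 - p)`, integrable since `p < 2`; near
infinity `s ^ (-1 - p)` is integrable since `0 < p`. -/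
theorem integrableOn_one_sub_cos_mul_rpow {p : ℝ} (hp₀ : 0 < p) (hp₂ : p < 2) (x : ℝ) :
    IntegrableOn (fun s : ℝ => (1 - Real.cos (x * s)) * s ^ (-1 - p)) (Set.Ioi 0) := by
  have hm : Measurable fun s : ℝ => (1 - Real.cos (x * s)) * s ^ (-1 - p) := by fun_prop
  rw [← Set.Ioc_union_Ioi_eq_Ioi (zero_le_one (α := ℝ))]
  refine IntegrableOn.union ?_ ?_
  · have h : IntegrableOn (fun s : ℝ => x ^ 2 / 2 * s ^ (1 - p)) (Set.Ioc 0 1) := by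
      refine Integrable.const_mul ?_ _
      have := intervalIntegral.intervalIntegrable_rpow' (a := 0) (b := 1) (r := 1 - p)
        (by linarith)
      rwa [intervalIntegrable_iff_integrableOn_Ioc_of_le zero_le_one] at this
    refine Integrable.mono' h hm.aestronglyMeasurable ?_
    refine (ae_restrict_iff' measurableSet_Ioc).2 (ae_of_all _ fun s hs => ?_)
    have hs0 : 0 < s := hs.1
    rw [Real.norm_of_nonneg (mul_nonneg (by linarith [Real.cos_le_one (x * s)])
      (Real.rpow_nonneg hs0.le _))]
    have h1 : s ^ (1 - p) = s ^ 2 * s ^ (-1 - p) := by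
      rw [← Real.rpow_natCast, ← Real.rpow_add hs0]; congr 1; push_cast; ring
    rw [h1, ← mul_assoc]
    refine mul_le_mul_of_nonneg_right ?_ (Real.rpow_nonneg hs0.le _)
    have := Real.one_sub_sq_div_two_le_cos (x := x * s)
    nlinarith
  · have h : IntegrableOn (fun s : ℝ => 2 * s ^ (-1 - p)) (Set.Ioi 1) :=
      (integrableOn_Ioi_rpow_of_lt (by linarith) one_pos).const_mul 2
    refine Integrable.mono' h hm.aestronglyMeasurable ?_
    refine (ae_restrict_iff' measurableSet_Ioi).2 (ae_of_all _ fun s hs => ?_)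
    have hs0 : 0 < s := one_pos.trans hs
    rw [Real.norm_of_nonneg (mul_nonneg (by linarith [Real.cos_le_one (x * s)])
      (Real.rpow_nonneg hs0.le _))]
    exact mul_le_mul_of_nonneg_right (by linarith [Real.neg_one_le_cos (x * s)])
      (Real.rpow_nonneg hs0.le _)

/-- Scaling `s` by `|x|` expresses `|x| ^ p` as a mixture of the functions `1 - cos (x s)`. -/
theorem integral_one_sub_cos_mul_rpow {p : ℝ} (hp₀ : 0 < p) (x : ℝ) :
    ∫ s in Set.Ioi (0 : ℝ), (1 - Real.cos (x * s)) * s ^ (-1 - p) =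
      |x| ^ p * ∫ s in Set.Ioi (0 : ℝ), (1 - Real.cos s) * s ^ (-1 - p) := by
  rcases eq_or_ne x 0 with rfl | hx
  · simp [Real.zero_rpow hp₀.ne']
  have hb : 0 < |x| := abs_pos.2 hx
  have h := integral_comp_mul_left_Ioi (fun s => (1 - Real.cos s) * s ^ (-1 - p)) 0 hb
  rw [mul_zero] at h
  have h2 : ∫ s in Set.Ioi (0 : ℝ), (1 - Real.cos (|x| * s)) * (|x| * s) ^ (-1 - p) =
      |x| ^ (-1 - p) * ∫ s in Set.Ioi (0 : ℝ), (1 - Real.cos (x * s)) * s ^ (-1 - p) := by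
    rw [← integral_const_mul]
    refine setIntegral_congr_fun measurableSet_Ioi fun s hs => ?_
    have hs0 : (0 : ℝ) < s := hs
    have hc : Real.cos (|x| * s) = Real.cos (x * s) := by
      rw [← Real.cos_abs (x * s), abs_mul, abs_of_pos hs0]
    change (1 - Real.cos (|x| * s)) * (|x| * s) ^ (-1 - p) = _
    rw [hc, Real.mul_rpow hb.le hs0.le]
    change _ = |x| ^ (-1 - p) * ((1 - Real.cos (x * s)) * s ^ (-1 - p))
    ring
  rw [h2, smul_eq_mul] at h
  have h3 : |x| ^ p * |x| * |x| ^ (-1 - p) = 1 := by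
    rw [← Real.rpow_add_one hb.ne', ← Real.rpow_add hb, ← Real.rpow_zero |x|]
    congr 1
    ring
  calc _ = |x| ^ p * |x| * (|x| ^ (-1 - p) *
        ∫ s in Set.Ioi (0 : ℝ), (1 - Real.cos (x * s)) * s ^ (-1 - p)) := by
        rw [← mul_assoc, h3, one_mul]
    _ = _ := by rw [h]; field_simp

theorem integral_one_sub_cos_mul_rpow_pos {p : ℝ} (hp₀ : 0 < p) (hp₂ : p < 2) :
    0 < ∫ s in Set.Ioi (0 : ℝ), (1 - Real.cos s) * s ^ (-1 - p) := by
  have hi := integrableOn_one_sub_cos_mul_rpow hp₀ hp₂ 1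
  simp only [one_mul] at hi
  rw [setIntegral_pos_iff_support_of_nonneg_ae ?_ hi]
  · refine lt_of_lt_of_le ?_ (measure_mono (s := Set.Ioo (0 : ℝ) 1) ?_)
    · simp
    · intro s hs
      refine ⟨?_, hs.1⟩
      have h1 : Real.cos s < 1 := by
        have := Real.cos_lt_cos_of_nonneg_of_le_pi (x := 0) (y := s) le_rfl
          (by linarith [hs.2, Real.pi_gt_three]) hs.1
        simpa using this
      exact (mul_pos (by linarith) (Real.rpow_pos_of_pos hs.1 _)).ne'
  · refine (ae_restrict_iff' measurableSet_Ioi).2 (ae_of_all _ fun s hs => ?_)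
    exact mul_nonneg (by linarith [Real.cos_le_one s]) (Real.rpow_nonneg (le_of_lt hs) _)

/-- Since the weights sum to zero, the constant in `1 - cos` drops out, and the cosine part is minus
a sum of two squares at each frequency. At `p = 2` the integral representation diverges, but the sum
expands directly to `-2 (∑ a i * x i) ^ 2`. -/
theorem sum_mul_abs_sub_rpow_nonpos {p : ℝ} (hp₀ : 0 < p) (hp₂ : p ≤ 2) {n : ℕ}
    (a x : Fin n → ℝ) (ha : ∑ i, a i = 0) :
    ∑ i, ∑ j, a i * a j * |x i - x j| ^ p ≤ 0 := by
  have haa : ∑ i, ∑ j, a i * a j = 0 := by rw [← Finset.sum_mul_sum, ha, zero_mul]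
  rcases hp₂.lt_or_eq with hp | rfl
  · have hpos := integral_one_sub_cos_mul_rpow_pos hp₀ hp
    refine nonpos_of_mul_nonpos_left ?_ hpos
    have h : (∑ i, ∑ j, a i * a j * |x i - x j| ^ p) *
        ∫ s in Set.Ioi (0 : ℝ), (1 - Real.cos s) * s ^ (-1 - p) =
        ∫ s in Set.Ioi (0 : ℝ), ∑ i, ∑ j,
          a i * a j * ((1 - Real.cos ((x i - x j) * s)) * s ^ (-1 - p)) := by
      have hint : ∀ i j, IntegrableOn (fun s : ℝ =>
          a i * a j * ((1 - Real.cos ((x i - x j) * s)) * s ^ (-1 - p))) (Set.Ioi 0) :=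
        fun i j => (integrableOn_one_sub_cos_mul_rpow hp₀ hp _).const_mul _
      rw [integral_finsetSum _ fun i _ => integrable_finsetSum _ fun j _ => hint i j,
        Finset.sum_mul]
      refine Finset.sum_congr rfl fun i _ => ?_
      rw [integral_finsetSum _ fun j _ => hint i j, Finset.sum_mul]
      refine Finset.sum_congr rfl fun j _ => ?_
      rw [integral_const_mul, integral_one_sub_cos_mul_rpow hp₀]
      ring
    rw [h]
    refine setIntegral_nonpos measurableSet_Ioi fun s hs => ?_
    have h1 : ∑ i, ∑ j, a i * a j * ((1 - Real.cos ((x i - x j) * s)) * s ^ (-1 - p)) =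
        (∑ i, ∑ j, a i * a j - ∑ i, ∑ j, a i * a j * Real.cos (x i * s - x j * s)) *
          s ^ (-1 - p) := by
      simp_rw [← Finset.sum_sub_distrib, Finset.sum_mul]
      refine Finset.sum_congr rfl fun i _ => Finset.sum_congr rfl fun j _ => ?_
      ring_nf
    rw [h1, haa, sum_mul_cos_sub]
    have hc := sq_nonneg (∑ i, a i * Real.cos (x i * s))
    have hd := sq_nonneg (∑ i, a i * Real.sin (x i * s))
    exact mul_nonpos_of_nonpos_of_nonneg (by linarith) (Real.rpow_nonneg (le_of_lt hs) _)
  · have h : ∑ i, ∑ j, a i * a j * |x i - x j| ^ (2 : ℝ) =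
        (∑ i, a i * x i ^ 2) * (∑ j, a j) + (∑ i, a i) * (∑ j, a j * x j ^ 2) -
          2 * ((∑ i, a i * x i) * (∑ j, a j * x j)) := by
      simp_rw [Finset.sum_mul_sum, Finset.mul_sum, ← Finset.sum_add_distrib,
        ← Finset.sum_sub_distrib]
      refine Finset.sum_congr rfl fun i _ => Finset.sum_congr rfl fun j _ => ?_
      rw [Real.rpow_two, sq_abs]
      ring
    rw [h, ha]
    nlinarith [sq_nonneg (∑ i, a i * x i)]

/-! ### Positive semi-definite matrices and Schoenberg's theorem -/

theorem posSemidef_of_iff {n : ℕ} {k : Fin n → Fin n → ℝ} :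
    (Matrix.of k).PosSemidef ↔
      (∀ i j, k i j = k j i) ∧ ∀ c : Fin n → ℝ, 0 ≤ ∑ i, ∑ j, c i * c j * k i j := by
  rw [Matrix.posSemidef_iff_dotProduct_mulVec]
  refine and_congr ?_ (forall_congr' fun c => ?_)
  · constructor
    · intro h i j
      have := congrFun (congrFun h j) i
      simpa using this
    · intro h
      ext i j
      simpa using h j i
  · simp only [dotProduct, Matrix.mulVec, Matrix.of_apply, Finset.mul_sum, Pi.star_apply,
      star_trivial]
    refine Eq.to_iff (congrArg _ (Finset.sum_congr rfl fun i _ =>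
      Finset.sum_congr rfl fun j _ => ?_))
    ring

/-- The entrywise exponential of a positive semi-definite matrix is positive semi-definite. -/
theorem posSemidef_exp {n : ℕ} {k : Fin n → Fin n → ℝ} (hk : (Matrix.of k).PosSemidef) :
    (Matrix.of fun i j => Real.exp (k i j)).PosSemidef := by
  -- Entrywise powers are handled by the Schur product theorem; the exponential series has
  -- nonnegative coefficients.
  have hpow : ∀ m : ℕ, (Matrix.of fun i j => k i j ^ m).PosSemidef := by
    intro m
    induction m with
    | zero =>
      simp only [pow_zero]
      refine posSemidef_of_iff.2 ⟨fun _ _ => rfl, fun c => ?_⟩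
      simp only [mul_one]
      rw [← Finset.sum_mul_sum]
      exact mul_self_nonneg _
    | succ m ih =>
      exact ih.hadamard hk
  refine posSemidef_of_iff.2 ⟨fun i j => by rw [(posSemidef_of_iff.1 hk).1 i j], fun c => ?_⟩
  have hlim : HasSum (fun m : ℕ => ∑ i, ∑ j, c i * c j * (k i j ^ m / m.factorial))
      (∑ i, ∑ j, c i * c j * Real.exp (k i j)) := by
    refine hasSum_sum fun i _ => hasSum_sum fun j _ => HasSum.mul_left _ ?_
    rw [Real.exp_eq_exp_ℝ]
    exact NormedSpace.expSeries_div_hasSum_exp (k i j)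
  refine hlim.nonneg fun m => ?_
  have := (posSemidef_of_iff.1 (hpow m)).2 c
  have h2 : ∑ i, ∑ j, c i * c j * (k i j ^ m / m.factorial) =
      (∑ i, ∑ j, c i * c j * k i j ^ m) / m.factorial := by
    simp_rw [Finset.sum_div, mul_div_assoc]
  rw [h2]
  positivity

/-- Schoenberg's theorem: the exponential of the opposite of a conditionally negative definite
function that vanishes on the diagonal is a positive semi-definite kernel. -/
theorem IsCND.isPSDKernel_exp_neg {X : Type*} {f : X → X → ℝ} (hf : IsCND f)
    (hs : ∀ x y, f x y = f y x) (h0 : ∀ x, f x x = 0) :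
    IsPSDKernel fun x y => Real.exp (-f x y) := by
  refine ⟨fun x y => by simp only [hs x y], fun n x => ?_⟩
  rcases n with _ | n
  · exact posSemidef_of_iff.2 ⟨fun i => i.elim0, fun c => by simp⟩
  have hK : (Matrix.of fun i j => f (x i) (x 0) + f (x 0) (x j) - f (x i) (x j)).PosSemidef := by
    refine posSemidef_of_iff.2 ⟨fun i j => ?_, fun c => ?_⟩
    · rw [hs (x i) (x j), hs (x i) (x 0), hs (x 0) (x j)]; ring
    · obtain ⟨S, hS⟩ : ∃ S, S = ∑ i, c i := ⟨_, rfl⟩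
      -- Adding the base point `x 0` with weight `-S` makes the total weight zero.
      have h := hf (n + 2) (Fin.cons (x 0) x) (Fin.cons (-S) c)
        (by simp [Fin.sum_univ_succ, hS])
      simp only [Fin.sum_univ_succ (n := n + 1), Fin.cons_zero, Fin.cons_succ, h0] at h
      have e : ∑ i, ∑ j, c i * c j * (f (x i) (x 0) + f (x 0) (x j) - f (x i) (x j)) =
          (∑ i, c i * f (x i) (x 0)) * (∑ j, c j) + (∑ i, c i) * (∑ j, c j * f (x 0) (x j)) -
            ∑ i, ∑ j, c i * c j * f (x i) (x j) := by
        simp_rw [Finset.sum_mul_sum, ← Finset.sum_add_distrib, ← Finset.sum_sub_distrib]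
        exact Finset.sum_congr rfl fun i _ => Finset.sum_congr rfl fun j _ => by ring
      rw [e, ← hS]
      rw [Finset.sum_add_distrib] at h
      have e1 : ∑ j, -S * c j * f (x 0) (x j) =
          -(S * ∑ j, c j * f (x 0) (x j)) := by
        rw [Finset.mul_sum, ← Finset.sum_neg_distrib]
        exact Finset.sum_congr rfl fun j _ => by ring
      have e2 : ∑ i, c i * -S * f (x i) (x 0) =
          -((∑ i, c i * f (x i) (x 0)) * S) := by
        rw [Finset.sum_mul, ← Finset.sum_neg_distrib]
        exact Finset.sum_congr rfl fun j _ => by ring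
      rw [e1, e2] at h
      linarith
  have hD : (Matrix.of fun i j => Real.exp (-f (x i) (x 0)) * Real.exp (-f (x j) (x 0))).PosSemidef := by
    refine posSemidef_of_iff.2 ⟨fun i j => mul_comm _ _, fun c => ?_⟩
    have : ∑ i, ∑ j, c i * c j * (Real.exp (-f (x i) (x 0)) * Real.exp (-f (x j) (x 0))) =
        (∑ i, c i * Real.exp (-f (x i) (x 0))) * ∑ i, c i * Real.exp (-f (x i) (x 0)) := by
      rw [Finset.sum_mul_sum]
      exact Finset.sum_congr rfl fun i _ => Finset.sum_congr rfl fun j _ => by ring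
    rw [this]
    exact mul_self_nonneg _
  -- The kernel is the Schur product of a rank-one matrix and the entrywise exponential of the
  -- matrix in `hK`.
  have hE : (Matrix.of fun i j => Real.exp (-f (x i) (x j))) =
      (Matrix.of fun i j => Real.exp (-f (x i) (x 0)) * Real.exp (-f (x j) (x 0))).hadamard
        (Matrix.of fun i j => Real.exp (f (x i) (x 0) + f (x 0) (x j) - f (x i) (x j))) := by
    ext i j
    simp only [Matrix.hadamard_apply, Matrix.of_apply, ← Real.exp_add]
    rw [hs (x 0) (x j)]
    congr 1
    ring
  rw [hE]
  exact hD.hadamard (posSemidef_exp hK)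

/-! ### Layer-cake formula for convex costs -/

/-- The function `c ↦ max c 0 ^ p` is a superposition of the functions `c ↦ max (c - r) 0`
with `0 ≤ r`. -/
theorem exists_lintegral_ofReal_sub_eq_rpow {p : ℝ} (hp : 1 ≤ p) :
    ∃ ρ : Measure ℝ, SFinite ρ ∧ (∀ᵐ r ∂ρ, 0 ≤ r) ∧
      ∀ c : ℝ, ∫⁻ r, ENNReal.ofReal (c - r) ∂ρ = ENNReal.ofReal c ^ p := by
  rcases hp.eq_or_lt with rfl | hp
  · refine ⟨Measure.dirac 0, inferInstance, ?_, fun c => by simp⟩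
    rw [ae_dirac_iff (measurableSet_Ici (a := (0 : ℝ)))]
  have hd : Measurable fun r : ℝ => ENNReal.ofReal (p * (p - 1) * r ^ (p - 2)) := by fun_prop
  -- The mixing density is the second derivative of `r ^ p`; at `p = 1` it degenerates to the Dirac
  -- mass at `0` used above.
  refine ⟨(volume.restrict (Set.Ioi 0)).withDensity
    fun r => ENNReal.ofReal (p * (p - 1) * r ^ (p - 2)), inferInstance, ?_, fun c => ?_⟩
  · refine (withDensity_absolutelyContinuous _ _).ae_le ?_
    exact (ae_restrict_iff' measurableSet_Ioi).2 (ae_of_all _ fun r hr => le_of_lt hr)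
  rw [lintegral_withDensity_eq_lintegral_mul _ hd (by fun_prop)]
  simp only [Pi.mul_apply]
  rcases le_or_gt c 0 with hc | hc
  · rw [ENNReal.ofReal_of_nonpos hc, ENNReal.zero_rpow_of_pos (by linarith),
      setLIntegral_eq_zero_iff measurableSet_Ioi (by fun_prop)]
    refine ae_of_all _ fun r hr => ?_
    rw [ENNReal.ofReal_of_nonpos (p := c - r) (by linarith [Set.mem_Ioi.1 hr]), mul_zero]
  have hii : IntervalIntegrable (fun r : ℝ => p * (p - 1) * r ^ (p - 2) * (c - r)) volume 0 c := by
    refine IntervalIntegrable.mul_continuousOn ?_ (by fun_prop)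
    exact (intervalIntegral.intervalIntegrable_rpow' (by linarith)).const_mul _
  have hval : ∫ r in (0 : ℝ)..c, p * (p - 1) * r ^ (p - 2) * (c - r) = c ^ p := by
    have h1 : ∫ r in (0 : ℝ)..c, p * (p - 1) * r ^ (p - 2) * (c - r) =
        ∫ r in (0 : ℝ)..c, (p * (p - 1) * c * r ^ (p - 2) - p * (p - 1) * r ^ (p - 1)) := by
      refine intervalIntegral.integral_congr_ae (ae_of_all _ fun r hr => ?_)
      rw [Set.uIoc_of_le hc.le] at hr
      have : r ^ (p - 1) = r ^ (p - 2) * r := by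
        rw [← Real.rpow_add_one hr.1.ne']; congr 1; ring
      rw [this]; ring
    rw [h1, intervalIntegral.integral_sub
      ((intervalIntegral.intervalIntegrable_rpow' (by linarith)).const_mul _)
      ((intervalIntegral.intervalIntegrable_rpow' (by linarith)).const_mul _),
      intervalIntegral.integral_const_mul, intervalIntegral.integral_const_mul,
      integral_rpow (Or.inl (by linarith)), integral_rpow (Or.inl (by linarith)),
      Real.zero_rpow (by linarith), Real.zero_rpow (by linarith)]
    have h2 : c ^ (p - 1 + 1) = c ^ p := by congr 1; ring
    have h3 : c * c ^ (p - 2 + 1) = c ^ p := by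
      rw [mul_comm, ← Real.rpow_add_one hc.ne']; congr 1; ring
    have hp1 : p - 1 ≠ 0 := by linarith
    have hp0 : p ≠ 0 := by linarith
    have h4 : p - 2 + 1 = p - 1 := by ring
    have h5 : p - 1 + 1 = p := by ring
    rw [sub_zero, sub_zero, h2, h4, h5]
    rw [h4] at h3
    field_simp
    linear_combination p * h3
  have hset : ∫⁻ r in Set.Ioi (0 : ℝ), ENNReal.ofReal (p * (p - 1) * r ^ (p - 2)) *
      ENNReal.ofReal (c - r) =
      ∫⁻ r in Set.Ioc 0 c, ENNReal.ofReal (p * (p - 1) * r ^ (p - 2) * (c - r)) := by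
    rw [← Set.Ioc_union_Ioi_eq_Ioi hc.le, lintegral_union measurableSet_Ioi
      (Set.Ioc_disjoint_Ioi le_rfl)]
    have hz : ∫⁻ r in Set.Ioi c, ENNReal.ofReal (p * (p - 1) * r ^ (p - 2)) *
        ENNReal.ofReal (c - r) = 0 := by
      rw [setLIntegral_eq_zero_iff measurableSet_Ioi (by fun_prop)]
      refine ae_of_all _ fun r hr => ?_
      rw [ENNReal.ofReal_of_nonpos (p := c - r) (by linarith [Set.mem_Ioi.1 hr]), mul_zero]
    rw [hz, add_zero]
    refine setLIntegral_congr_fun measurableSet_Ioc fun r hr => ?_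
    have : 0 ≤ p * (p - 1) * r ^ (p - 2) :=
      mul_nonneg (mul_nonneg (by linarith) (by linarith)) (Real.rpow_nonneg hr.1.le _)
    exact (ENNReal.ofReal_mul this).symm
  rw [hset, ← ofReal_integral_eq_lintegral_ofReal, ← intervalIntegral.integral_of_le hc.le, hval,
    ENNReal.ofReal_rpow_of_pos hc]
  · exact (intervalIntegrable_iff_integrableOn_Ioc_of_le hc.le).1 hii
  · refine (ae_restrict_iff' measurableSet_Ioc).2 (ae_of_all _ fun r hr => ?_)
    exact mul_nonneg (mul_nonneg (mul_nonneg (by linarith) (by linarith))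
      (Real.rpow_nonneg hr.1.le _)) (by linarith [hr.2])

/-- Layer-cake formula for the convex cost `max (g - f) 0 ^ p`. -/
theorem lintegral_ofReal_sub_rpow_eq {p : ℝ} {ρ : Measure ℝ} [SFinite ρ]
    (hρ : ∀ c : ℝ, ∫⁻ r, ENNReal.ofReal (c - r) ∂ρ = ENNReal.ofReal c ^ p)
    {X : Type*} [MeasurableSpace X] (G : Measure X) [SFinite G] {f g : X → ℝ}
    (hf : Measurable f) (hg : Measurable g) :
    ∫⁻ x, ENNReal.ofReal (g x - f x) ^ p ∂G =
      ∫⁻ q : ℝ × ℝ, G {x | f x ≤ q.2 ∧ q.2 + q.1 < g x} ∂(ρ.prod volume) := by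
  have hS : MeasurableSet {z : X × (ℝ × ℝ) | f z.1 ≤ z.2.2 ∧ z.2.2 + z.2.1 < g z.1} := by
    rw [Set.ofPred_and]
    exact (measurableSet_le (by fun_prop) (by fun_prop)).inter
      (measurableSet_lt (by fun_prop) (by fun_prop))
  -- Tonelli: for fixed `x` and `r`, the admissible `a` form the interval `[f x, g x - r)`, of
  -- length the positive part of `g x - f x - r`.
  have h1 := Measure.prod_apply (μ := G) (ν := ρ.prod volume) hS
  rw [Measure.prod_apply_symm hS] at h1
  refine Eq.trans (lintegral_congr fun x => ?_) h1.symm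
  rw [Measure.prod_apply (measurable_prodMk_left hS), ← hρ]
  refine lintegral_congr fun r => ?_
  have : Prod.mk r ⁻¹' (Prod.mk x ⁻¹'
      {z : X × (ℝ × ℝ) | f z.1 ≤ z.2.2 ∧ z.2.2 + z.2.1 < g z.1}) = Set.Ico (f x) (g x - r) := by
    ext a
    simp [lt_sub_iff_add_lt]
  rw [this, Real.volume_Ico]
  congr 1
  ring

theorem ofReal_abs_rpow_eq_add {p : ℝ} (hp : 0 < p) (x y : ℝ) :
    ENNReal.ofReal |x - y| ^ p = ENNReal.ofReal (y - x) ^ p + ENNReal.ofReal (x - y) ^ p := by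
  rcases le_total x y with h | h
  · rw [ENNReal.ofReal_of_nonpos (sub_nonpos.2 h), ENNReal.zero_rpow_of_pos hp, add_zero, abs_sub_comm,
      abs_of_nonneg (sub_nonneg.2 h)]
  · rw [ENNReal.ofReal_of_nonpos (sub_nonpos.2 h), ENNReal.zero_rpow_of_pos hp, zero_add,
      abs_of_nonneg (sub_nonneg.2 h)]

/-! ### Quantile functions -/

/-- The quantile function of a measure on the line, counted from above. -/
noncomputable def quantile (m : Measure ℝ) (u : ℝ) : ℝ :=
  (⨆ q : ℚ, if ENNReal.ofReal u < m (Set.Ioi q) then ENNReal.ofReal q else 0).toReal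

theorem quantile_nonneg (m : Measure ℝ) (u : ℝ) : 0 ≤ quantile m u := ENNReal.toReal_nonneg

/-- The condition that a measure on the line has finite mass away from `0` on the right. -/
def HasFiniteTails (m : Measure ℝ) : Prop := ∀ s : ℝ, 0 < s → m (Set.Ioi s) < ∞

theorem HasFiniteTails.exists_lt {m : Measure ℝ} (hm : HasFiniteTails m) {ε : ℝ≥0∞} (hε : 0 < ε) :
    ∃ s : ℝ, 0 < s ∧ m (Set.Ioi s) < ε := by
  have h : Filter.Tendsto (fun n : ℕ => m (Set.Ioi ((n : ℝ) + 1))) Filter.atTop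
      (nhds (m (⋂ n : ℕ, Set.Ioi ((n : ℝ) + 1)))) := by
    refine tendsto_measure_iInter_atTop (fun n => measurableSet_Ioi.nullMeasurableSet) ?_
      ⟨0, (hm _ (by simp)).ne⟩
    intro a b hab
    exact Set.Ioi_subset_Ioi (by have : (a : ℝ) ≤ b := by exact_mod_cast hab
                                 linarith)
  have h0 : (⋂ n : ℕ, Set.Ioi ((n : ℝ) + 1)) = ∅ := by
    ext x
    simp only [Set.mem_iInter, Set.mem_Ioi, Set.mem_empty_iff_false, iff_false, not_forall, not_lt]
    obtain ⟨n, hn⟩ := exists_nat_ge x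
    exact ⟨n, by linarith⟩
  rw [h0, measure_empty] at h
  obtain ⟨n, hn⟩ := (h.eventually_lt_const hε).exists
  exact ⟨n + 1, by positivity, hn⟩

theorem lt_quantile_iff {m : Measure ℝ} (hm : HasFiniteTails m) {s u : ℝ} (hs : 0 ≤ s)
    (hu : 0 < u) : s < quantile m u ↔ ENNReal.ofReal u < m (Set.Ioi s) := by
  -- Finiteness matters because `toReal` would send an infinite supremum to `0`.
  have hfin : (⨆ q : ℚ, if ENNReal.ofReal u < m (Set.Ioi q) then ENNReal.ofReal q else 0) ≠ ∞ := by
    obtain ⟨S, hS, hlt⟩ := hm.exists_lt (ENNReal.ofReal_pos.2 hu)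
    refine ne_top_of_le_ne_top (ENNReal.ofReal_ne_top (r := S)) (iSup_le fun q => ?_)
    split_ifs with h
    · refine ENNReal.ofReal_le_ofReal (le_of_not_ge fun hq => ?_)
      exact lt_irrefl _ (h.trans_le ((measure_mono (Set.Ioi_subset_Ioi hq)).trans hlt.le))
    · exact zero_le
  rw [quantile, ← ENNReal.ofReal_lt_iff_lt_toReal hs hfin, lt_iSup_iff]
  constructor
  · rintro ⟨q, hq⟩
    split_ifs at hq with h
    · exact h.trans_le (measure_mono (Set.Ioi_subset_Ioi
        (ENNReal.ofReal_lt_ofReal_iff'.1 hq).1.le))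
    · exact absurd hq not_lt_zero
  · intro h
    have hU : Set.Ioi s = ⋃ q : {q : ℚ // s < q}, Set.Ioi ((q : ℚ) : ℝ) := by
      ext x
      simp only [Set.mem_Ioi, Set.mem_iUnion, Subtype.exists, exists_prop]
      exact ⟨fun h => exists_rat_btwn h, fun ⟨q, h1, h2⟩ => h1.trans h2⟩
    have hdir : Directed (· ⊆ ·) fun q : {q : ℚ // s < q} => Set.Ioi ((q : ℚ) : ℝ) := by
      refine directed_of_isDirected_ge fun a b hab => Set.Ioi_subset_Ioi ?_
      exact_mod_cast hab
    rw [hU, hdir.measure_iUnion, lt_iSup_iff] at h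
    obtain ⟨q, hq⟩ := h
    refine ⟨q, ?_⟩
    rw [if_pos hq]
    exact (ENNReal.ofReal_lt_ofReal_iff (hs.trans_lt q.2)).2 q.2

theorem measurable_quantile_prod {T : Type*} [MeasurableSpace T] {m : T → Measure ℝ}
    (hm : ∀ s : ℝ, Measurable fun t => m t (Set.Ioi s)) :
    Measurable fun z : T × ℝ => quantile (m z.1) z.2 := by
  refine ENNReal.measurable_toReal.comp (Measurable.iSup fun q => Measurable.ite ?_ ?_ ?_)
  · exact measurableSet_lt (by fun_prop) ((hm q).comp measurable_fst)
  · exact measurable_const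
  · exact measurable_const

theorem measurable_quantile (m : Measure ℝ) : Measurable fun u => quantile m u := by
  refine ENNReal.measurable_toReal.comp (Measurable.iSup fun q => Measurable.ite ?_ ?_ ?_)
  · exact measurableSet_lt (by fun_prop) measurable_const
  · exact measurable_const
  · exact measurable_const

theorem volume_setOf_lt_quantile {m : Measure ℝ} (hm : HasFiniteTails m) {s : ℝ} (hs : 0 ≤ s) :
    volume.restrict (Set.Ioi 0) {u : ℝ | s < quantile m u} = m (Set.Ioi s) := by
  rw [Measure.restrict_apply (measurableSet_lt measurable_const (measurable_quantile m))]
  have : {u : ℝ | s < quantile m u} ∩ Set.Ioi 0 =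
      {u : ℝ | ENNReal.ofReal u < m (Set.Ioi s)} ∩ Set.Ioi 0 := by
    ext u
    simp only [Set.mem_inter_iff, Set.mem_ofPred_eq, Set.mem_Ioi]
    exact and_congr_left fun hu => lt_quantile_iff hm hs hu
  rw [this]
  by_cases h : m (Set.Ioi s) = ∞
  · simp [h]
  · have : {u : ℝ | ENNReal.ofReal u < m (Set.Ioi s)} ∩ Set.Ioi 0 =
        Set.Ioo 0 (m (Set.Ioi s)).toReal := by
      ext u
      simp only [Set.mem_inter_iff, Set.mem_ofPred_eq, Set.mem_Ioi, Set.mem_Ioo]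
      rw [and_comm]
      exact and_congr_right fun hu => ENNReal.ofReal_lt_iff_lt_toReal hu.le h
    rw [this, Real.volume_Ioo, sub_zero, ENNReal.ofReal_toReal h]

/-- The quantile function pushes Lebesgue measure on the half-line to the given measure. -/
theorem map_quantile_restrict {m : Measure ℝ} (hm : HasFiniteTails m) :
    ((volume.restrict (Set.Ioi 0)).map (quantile m)).restrict (Set.Ioi 0) =
      m.restrict (Set.Ioi 0) := by
  have hU : Set.Ioi (0 : ℝ) = ⋃ n : ℕ, Set.Ioi (1 / ((n : ℝ) + 1)) := by
    ext x
    simp only [Set.mem_Ioi, Set.mem_iUnion]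
    exact ⟨fun h => exists_nat_one_div_lt h, fun ⟨n, hn⟩ => lt_trans (by positivity) hn⟩
  have key : ∀ s : ℝ, 0 ≤ s →
      (volume.restrict (Set.Ioi 0)).map (quantile m) (Set.Ioi s) = m (Set.Ioi s) := fun s hs => by
    rw [Measure.map_apply (measurable_quantile m) measurableSet_Ioi]
    exact volume_setOf_lt_quantile hm hs
  rw [hU, Measure.restrict_iUnion_congr, ← hU]
  intro n
  -- Away from `0` both measures are finite, so agreement on the π-system of half-lines suffices.
  have hn : (0 : ℝ) < 1 / ((n : ℝ) + 1) := by positivity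
  have hlt := hm _ hn
  have : IsFiniteMeasure (((volume.restrict (Set.Ioi 0)).map (quantile m)).restrict
      (Set.Ioi (1 / ((n : ℝ) + 1)))) := ⟨by rwa [Measure.restrict_apply_univ, key _ hn.le]⟩
  refine ext_of_generate_finite (Set.range Set.Ioi) (borel_eq_generateFrom_Ioi ℝ ▸
    BorelSpace.measurable_eq) isPiSystem_Ioi ?_ ?_
  · rintro _ ⟨a, rfl⟩
    rw [Measure.restrict_apply measurableSet_Ioi, Measure.restrict_apply measurableSet_Ioi,
      Set.Ioi_inter_Ioi, key _ (hn.le.trans le_sup_right)]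
  · rw [Measure.restrict_apply_univ, Measure.restrict_apply_univ, key _ hn.le]

/-! ### Optimality of the quantile coupling -/

/-- Tail estimate behind the optimality of the quantile coupling. -/
theorem volume_quantile_le_lt_quantile_le {m n : Measure ℝ} (hm : HasFiniteTails m)
    (hn : HasFiniteTails n) {X : Type*} [MeasurableSpace X] (G : Measure X) {f g : X → ℝ}
    (hfG : ∀ s, 0 ≤ s → G {x | s < f x} = m (Set.Ioi s))
    (hgG : ∀ s, 0 ≤ s → G {x | s < g x} = n (Set.Ioi s)) {a r : ℝ} (hr : 0 ≤ r) :
    volume.restrict (Set.Ioi 0) {u | quantile m u ≤ a ∧ a + r < quantile n u} ≤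
      G {x | f x ≤ a ∧ a + r < g x} := by
  rcases lt_or_ge a 0 with ha | ha
  · have : {u | quantile m u ≤ a ∧ a + r < quantile n u} = ∅ := by
      ext u
      simp only [Set.mem_ofPred_eq, Set.mem_empty_iff_false, iff_false]
      exact fun h => absurd (quantile_nonneg m u) (by linarith [h.1])
    simp [this]
  have h1 : volume.restrict (Set.Ioi 0) {u | quantile m u ≤ a ∧ a + r < quantile n u} ≤
      n (Set.Ioi (a + r)) - m (Set.Ioi a) := by
    rw [Set.ofPred_and, Measure.restrict_apply
      ((measurableSet_le (measurable_quantile m) measurable_const).inter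
        (measurableSet_lt measurable_const (measurable_quantile n)))]
    have hsub : {u | quantile m u ≤ a} ∩ {u | a + r < quantile n u} ∩ Set.Ioi 0 ⊆
        {u | 0 < u ∧ m (Set.Ioi a) ≤ ENNReal.ofReal u ∧ ENNReal.ofReal u < n (Set.Ioi (a + r))} := by
      rintro u ⟨⟨h1, h2⟩, hu⟩
      exact ⟨hu, not_lt.1 fun h => not_lt.2 h1 ((lt_quantile_iff hm ha hu).2 h),
        (lt_quantile_iff hn (by positivity) hu).1 h2⟩
    refine (measure_mono hsub).trans ?_
    by_cases hA : m (Set.Ioi a) = ∞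
    · simp [hA]
    by_cases hB : n (Set.Ioi (a + r)) = ∞
    · rw [hB, ENNReal.top_sub hA]; exact le_top
    refine (measure_mono (t := Set.Ico (m (Set.Ioi a)).toReal (n (Set.Ioi (a + r))).toReal)
      ?_).trans ?_
    · rintro u ⟨hu, h1, h2⟩
      exact ⟨(ENNReal.le_ofReal_iff_toReal_le hA hu.le).1 h1,
        (ENNReal.ofReal_lt_iff_lt_toReal hu.le hB).1 h2⟩
    · rw [Real.volume_Ico, ENNReal.ofReal_sub _ ENNReal.toReal_nonneg, ENNReal.ofReal_toReal hA,
        ENNReal.ofReal_toReal hB]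
  refine h1.trans (tsub_le_iff_right.2 ?_)
  rw [← hgG _ (by positivity), ← hfG _ ha]
  -- Where `a + r < g`, either `f ≤ a` or `a < f`, and the latter has mass `m (Set.Ioi a)`: any
  -- coupling must respect the difference of tails.
  refine (measure_mono fun x hx => ?_).trans (measure_union_le _ _)
  rcases le_or_gt (f x) a with h | h
  · exact Or.inl ⟨h, hx⟩
  · exact Or.inr h

/-- The quantile coupling is optimal for the costs `|x - y| ^ p` with `1 ≤ p`, among all couplings
whose marginals are prescribed on the open half-line only. -/
theorem lintegral_quantile_le {p : ℝ} (hp : 1 ≤ p) {m n : Measure ℝ} (hm : HasFiniteTails m)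
    (hn : HasFiniteTails n) {X : Type*} [MeasurableSpace X] (G : Measure X) [SFinite G]
    {f g : X → ℝ} (hf : Measurable f) (hg : Measurable g)
    (hfG : ∀ s, 0 ≤ s → G {x | s < f x} = m (Set.Ioi s))
    (hgG : ∀ s, 0 ≤ s → G {x | s < g x} = n (Set.Ioi s)) :
    ∫⁻ u in Set.Ioi 0, ENNReal.ofReal |quantile m u - quantile n u| ^ p ≤
      ∫⁻ x, ENNReal.ofReal |f x - g x| ^ p ∂G := by
  obtain ⟨ρ, _, hρ0, hρ⟩ := exists_lintegral_ofReal_sub_eq_rpow hp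
  simp_rw [ofReal_abs_rpow_eq_add (zero_lt_one.trans_le hp)]
  have hmm := measurable_quantile m
  have hmn := measurable_quantile n
  rw [lintegral_add_left (by fun_prop), lintegral_add_left (by fun_prop),
    lintegral_ofReal_sub_rpow_eq hρ _ hmm hmn, lintegral_ofReal_sub_rpow_eq hρ _ hmn hmm,
    lintegral_ofReal_sub_rpow_eq hρ _ hf hg, lintegral_ofReal_sub_rpow_eq hρ _ hg hf]
  have hae : ∀ᵐ q : ℝ × ℝ ∂(ρ.prod volume), 0 ≤ q.1 :=
    Measure.quasiMeasurePreserving_fst.ae hρ0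
  refine add_le_add (lintegral_mono_ae ?_) (lintegral_mono_ae ?_)
  · filter_upwards [hae] with q hq
    exact volume_quantile_le_lt_quantile_le hm hn G hfG hgG hq
  · filter_upwards [hae] with q hq
    exact volume_quantile_le_lt_quantile_le hn hm G hgG hfG hq

/-! ### Heights and rays in the half-plane -/

/-- The signed distance of a point of the plane to the diagonal. -/
noncomputable def height (z : Plane) : ℝ := (z 1 - z 0) / √2

/-- The point at height `s` on the line orthogonal to the diagonal through `(t, t)`. -/
noncomputable def rayPoint (t s : ℝ) : Plane := !₂[t - s / √2, t + s / √2]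

@[fun_prop]
theorem continuous_height : Continuous height := by
  unfold height
  fun_prop

@[fun_prop]
theorem continuous_rayPoint (t : ℝ) : Continuous (rayPoint t) := by
  refine (PiLp.continuous_toLp 2 _).comp (continuous_pi fun i => ?_)
  fin_cases i <;> simp <;> fun_prop

theorem mem_Omega_iff {z : Plane} : z ∈ Omega ↔ 0 < height z := by
  have h : (0 : ℝ) < √2 := by positivity
  rw [height, div_pos_iff_of_pos_right h, sub_pos]
  rfl

theorem mem_OmegaBar_iff {z : Plane} : z ∈ OmegaBar ↔ 0 ≤ height z := by
  have h : (0 : ℝ) < √2 := by positivity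
  rw [height, le_div_iff₀ h, zero_mul, sub_nonneg]
  rfl

theorem mem_Diagonal_iff {z : Plane} : z ∈ Diagonal ↔ height z = 0 := by
  have h : √2 ≠ 0 := by positivity
  rw [height, div_eq_zero_iff, or_iff_left h, sub_eq_zero, eq_comm]
  rfl

theorem measurableSet_Omega : MeasurableSet Omega := by
  have : Omega = {z | 0 < height z} := Set.ext fun z => mem_Omega_iff
  rw [this]
  exact measurableSet_lt measurable_const (by fun_prop)

theorem measurableSet_OmegaBar : MeasurableSet OmegaBar := by
  have : OmegaBar = {z | 0 ≤ height z} := Set.ext fun z => mem_OmegaBar_iff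
  rw [this]
  exact measurableSet_le measurable_const (by fun_prop)

@[simp]
theorem height_rayPoint (t s : ℝ) : height (rayPoint t s) = s := by
  have h : √2 * √2 = 2 := Real.mul_self_sqrt (by norm_num)
  have h0 : √2 ≠ 0 := by positivity
  simp only [height, rayPoint, PiLp.toLp_apply, Matrix.cons_val_one, Matrix.cons_val_zero]
  field_simp
  rw [sq, h]
  ring

theorem abs_height_sub_le (x y : Plane) : |height x - height y| ≤ dist x y := by
  have h0 : (0 : ℝ) < √2 := by positivity
  have h2 : √2 ^ 2 = 2 := Real.sq_sqrt (by norm_num)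
  rw [EuclideanSpace.dist_eq]
  refine Real.abs_le_sqrt ?_
  simp only [Fin.sum_univ_two, Real.dist_eq, sq_abs, height]
  rw [← sub_div, div_pow, h2]
  nlinarith [sq_nonneg ((x 0 - y 0) + (x 1 - y 1))]

theorem dist_rayPoint (t s s' : ℝ) : dist (rayPoint t s) (rayPoint t s') = |s - s'| := by
  have h2 : √2 ^ 2 = 2 := Real.sq_sqrt (by norm_num)
  rw [EuclideanSpace.dist_eq, ← Real.sqrt_sq_eq_abs]
  congr 1
  simp only [Fin.sum_univ_two, Real.dist_eq, sq_abs, rayPoint, PiLp.toLp_apply,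
    Matrix.cons_val_one, Matrix.cons_val_zero]
  have e1 : t - s / √2 - (t - s' / √2) = -((s - s') / √2) := by ring
  have e2 : t + s / √2 - (t + s' / √2) = (s - s') / √2 := by ring
  rw [e1, e2, neg_sq, div_pow, h2]
  ring

theorem distDiag_eq {z : Plane} (hz : z ∈ OmegaBar) : distDiag z = ENNReal.ofReal (height z) := by
  have hz0 := mem_OmegaBar_iff.1 hz
  refine le_antisymm ?_ (Metric.le_infEDist.2 fun w hw => ?_)
  · have hm : rayPoint ((z 0 + z 1) / 2) 0 ∈ Diagonal := mem_Diagonal_iff.2 (height_rayPoint _ _)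
    refine (Metric.infEDist_le_edist_of_mem hm).trans (le_of_eq ?_)
    have hzr : rayPoint ((z 0 + z 1) / 2) (height z) = z := by
      have h : √2 * √2 = 2 := Real.mul_self_sqrt (by norm_num)
      have e : height z / √2 = (z 1 - z 0) / 2 := by rw [height, div_div, h]
      ext i
      fin_cases i <;> simp [rayPoint, e] <;> ring
    nth_rewrite 1 [← hzr]
    rw [edist_dist, dist_rayPoint, sub_zero, abs_of_nonneg hz0]
  · rw [edist_dist]
    refine ENNReal.ofReal_le_ofReal ?_
    have := abs_height_sub_le z w
    rwa [mem_Diagonal_iff.1 hw, sub_zero, abs_of_nonneg hz0] at this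

theorem map_rayPoint_apply (m : Measure ℝ) (t : ℝ) {A : Set Plane} (hA : A ⊆ Omega)
    (hAm : MeasurableSet A) :
    (m.restrict (Set.Ioi 0)).map (rayPoint t) A = m (rayPoint t ⁻¹' A) := by
  have hm : Measurable (rayPoint t) := (continuous_rayPoint t).measurable
  rw [Measure.map_apply hm hAm, Measure.restrict_apply (hm hAm), Set.inter_eq_left.2]
  intro s hs
  have := mem_Omega_iff.1 (hA hs)
  rwa [height_rayPoint] at this

theorem map_rayPoint_setOf_lt_height (m : Measure ℝ) (t : ℝ) {s : ℝ} (hs : 0 ≤ s) :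
    (m.restrict (Set.Ioi 0)).map (rayPoint t) {z | s < height z} = m (Set.Ioi s) := by
  rw [map_rayPoint_apply m t (A := {z | s < height z}) (fun z hz => mem_Omega_iff.2 (hs.trans_lt hz))
    (measurableSet_lt measurable_const (by fun_prop))]
  congr 1
  ext x
  simp

theorem volume_rayPoint_quantile_mem {m : Measure ℝ} (hm : HasFiniteTails m) (t : ℝ) {A : Set Plane}
    (hA : A ⊆ Omega) (hAm : MeasurableSet A) :
    volume.restrict (Set.Ioi 0) {u | rayPoint t (quantile m u) ∈ A} =
      (m.restrict (Set.Ioi 0)).map (rayPoint t) A := by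
  have hr : Measurable (rayPoint t) := (continuous_rayPoint t).measurable
  rw [← map_quantile_restrict hm, map_rayPoint_apply _ t hA hAm,
    Measure.map_apply (measurable_quantile m) (hr hAm)]
  rfl

/-! ### The Figalli-Gigli distance on a ray -/

/-- The coupling of two measures on a ray that is induced by their quantile functions. -/
noncomputable def quantilePlan (t : ℝ) (m n : Measure ℝ) : Measure (Plane × Plane) :=
  (volume.restrict (Set.Ioi 0)).map
    fun u => (rayPoint t (quantile m u), rayPoint t (quantile n u))

theorem measurable_rayPoint_quantile (t : ℝ) (m : Measure ℝ) :
    Measurable fun u => rayPoint t (quantile m u) :=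
  (continuous_rayPoint t).measurable.comp (measurable_quantile m)

theorem rayPoint_quantile_mem_OmegaBar (t : ℝ) (m : Measure ℝ) (u : ℝ) :
    rayPoint t (quantile m u) ∈ OmegaBar :=
  mem_OmegaBar_iff.2 (by rw [height_rayPoint]; exact quantile_nonneg m u)

theorem quantilePlan_mem_Adm {m n : Measure ℝ} (hm : HasFiniteTails m) (hn : HasFiniteTails n)
    (t : ℝ) : quantilePlan t m n ∈
      Adm ((m.restrict (Set.Ioi 0)).map (rayPoint t)) ((n.restrict (Set.Ioi 0)).map (rayPoint t)) := by
  have hmeas : Measurable fun u => (rayPoint t (quantile m u), rayPoint t (quantile n u)) :=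
    (measurable_rayPoint_quantile t m).prodMk (measurable_rayPoint_quantile t n)
  refine ⟨?_, fun K hK hKc => ?_, fun A hA hAm => ?_, fun B hB hBm => ?_⟩
  · rw [quantilePlan, Measure.map_apply hmeas
      (measurableSet_OmegaBar.prod measurableSet_OmegaBar).compl]
    refine (congrArg _ ?_).trans measure_empty
    ext u
    simp [rayPoint_quantile_mem_OmegaBar]
  · rcases K.eq_empty_or_nonempty with rfl | hne
    · simp
    -- By compactness the larger of the two heights is bounded below on `K` by a positive constant,
    -- so `K` lies in two tails of finite mass.
    obtain ⟨z₀, hz₀, hmin⟩ := hKc.exists_isMinOn hne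
      (f := fun z => max (height z.1) (height z.2)) (by fun_prop)
    have hpos : 0 < max (height z₀.1) (height z₀.2) := by
      obtain ⟨⟨h1, h2⟩, h3⟩ := hK hz₀
      rw [mem_OmegaBar_iff] at h1 h2
      refine lt_of_not_ge fun h => h3 ⟨mem_Diagonal_iff.2 ?_, mem_Diagonal_iff.2 ?_⟩
      · exact le_antisymm ((le_max_left _ _).trans h) h1
      · exact le_antisymm ((le_max_right _ _).trans h) h2
    obtain ⟨ε, hε, hlt⟩ := exists_between hpos
    have hsub : K ⊆ {z : Plane × Plane | ε < height z.1} ∪ {z | ε < height z.2} := fun z hz =>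
      lt_max_iff.1 (hlt.trans_le (hmin hz))
    have h1 : MeasurableSet {z : Plane × Plane | ε < height z.1} :=
      measurableSet_lt measurable_const (by fun_prop)
    have h2 : MeasurableSet {z : Plane × Plane | ε < height z.2} :=
      measurableSet_lt measurable_const (by fun_prop)
    refine (measure_mono hsub).trans_lt ((measure_union_le _ _).trans_lt (ENNReal.add_lt_top.2 ⟨?_, ?_⟩))
    · rw [quantilePlan, Measure.map_apply hmeas h1]
      simp only [Set.preimage_ofPred_eq, height_rayPoint]
      rw [volume_setOf_lt_quantile hm hε.le]
      exact hm ε hε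
    · rw [quantilePlan, Measure.map_apply hmeas h2]
      simp only [Set.preimage_ofPred_eq, height_rayPoint]
      rw [volume_setOf_lt_quantile hn hε.le]
      exact hn ε hε
  · rw [quantilePlan, Measure.map_apply hmeas (hAm.prod measurableSet_OmegaBar),
      ← volume_rayPoint_quantile_mem hm t hA hAm]
    congr 1
    ext u
    simp [rayPoint_quantile_mem_OmegaBar]
  · rw [quantilePlan, Measure.map_apply hmeas (measurableSet_OmegaBar.prod hBm),
      ← volume_rayPoint_quantile_mem hn t hB hBm]
    congr 1
    ext u
    simp [rayPoint_quantile_mem_OmegaBar]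

/-- A plan is carried by `OmegaBar ×ˢ OmegaBar`, so the constraint on the second factor can be
dropped. -/
theorem Adm.setOf_lt_height_fst {μ ν : Measure Plane} {γ : Measure (Plane × Plane)}
    (hγ : γ ∈ Adm μ ν) {s : ℝ} (hs : 0 ≤ s) :
    γ {z | s < height z.1} = μ {z | s < height z} := by
  rw [← hγ.2.2.1 {z | s < height z} (fun z hz => mem_Omega_iff.2 (hs.trans_lt hz))
    (measurableSet_lt measurable_const (by fun_prop))]
  refine measure_congr ?_
  have h : ∀ᵐ z ∂γ, z ∈ OmegaBar ×ˢ OmegaBar := hγ.1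
  filter_upwards [h] with z hz
  exact propext ⟨fun h => ⟨h, hz.2⟩, fun h => h.1⟩

theorem Adm.setOf_lt_height_snd {μ ν : Measure Plane} {γ : Measure (Plane × Plane)}
    (hγ : γ ∈ Adm μ ν) {s : ℝ} (hs : 0 ≤ s) :
    γ {z | s < height z.2} = ν {z | s < height z} := by
  rw [← hγ.2.2.2 {z | s < height z} (fun z hz => mem_Omega_iff.2 (hs.trans_lt hz))
    (measurableSet_lt measurable_const (by fun_prop))]
  refine measure_congr ?_
  have h : ∀ᵐ z ∂γ, z ∈ OmegaBar ×ˢ OmegaBar := hγ.1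
  filter_upwards [h] with z hz
  exact propext ⟨fun h => ⟨hz.1, h⟩, fun h => h.2⟩

theorem lintegral_quantile_le_of_mem_Adm {p : ℝ} (hp : 1 ≤ p) {m n : Measure ℝ}
    (hm : HasFiniteTails m) (hn : HasFiniteTails n) (t : ℝ) {γ : Measure (Plane × Plane)}
    (hγ : γ ∈ Adm ((m.restrict (Set.Ioi 0)).map (rayPoint t))
      ((n.restrict (Set.Ioi 0)).map (rayPoint t))) :
    ∫⁻ u in Set.Ioi 0, ENNReal.ofReal |quantile m u - quantile n u| ^ p ≤
      ∫⁻ z, edist z.1 z.2 ^ p ∂γ := by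
  have h1 : ∀ s, 0 ≤ s → γ {z | s < height z.1} = m (Set.Ioi s) := fun s hs =>
    (Adm.setOf_lt_height_fst hγ hs).trans (map_rayPoint_setOf_lt_height m t hs)
  have h2 : ∀ s, 0 ≤ s → γ {z | s < height z.2} = n (Set.Ioi s) := fun s hs =>
    (Adm.setOf_lt_height_snd hγ hs).trans (map_rayPoint_setOf_lt_height n t hs)
  have hms1 : ∀ s : ℝ, MeasurableSet {z : Plane × Plane | s < height z.1} := fun s =>
    measurableSet_lt measurable_const (by fun_prop)
  have hms2 : ∀ s : ℝ, MeasurableSet {z : Plane × Plane | s < height z.2} := fun s =>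
    measurableSet_lt measurable_const (by fun_prop)
  -- The mass between diagonal points is unconstrained and may fail to be s-finite. Restricting to
  -- `S 0` discards it, keeps the tails and does not increase the cost.
  let S : ℝ → Set (Plane × Plane) := fun s => {z | s < height z.1} ∪ {z | s < height z.2}
  have hS : ∀ s, MeasurableSet (S s) := fun s => (hms1 s).union (hms2 s)
  have hsf : SigmaFinite (γ.restrict (S 0)) := by
    refine ⟨⟨⟨fun k : ℕ => S (1 / ((k : ℝ) + 1)) ∪ (S 0)ᶜ, fun _ => trivial, fun k => ?_, ?_⟩⟩⟩
    · have hk : (0 : ℝ) < 1 / ((k : ℝ) + 1) := by positivity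
      refine (measure_union_le _ _).trans_lt (ENNReal.add_lt_top.2 ⟨?_, ?_⟩)
      · refine (Measure.restrict_apply_le _ _).trans_lt ((measure_union_le _ _).trans_lt ?_)
        rw [h1 _ hk.le, h2 _ hk.le]
        exact ENNReal.add_lt_top.2 ⟨hm _ hk, hn _ hk⟩
      · rw [Measure.restrict_apply (hS 0).compl, Set.compl_inter_self, measure_empty]
        exact ENNReal.zero_lt_top
    · refine Set.eq_univ_of_forall fun z => Set.mem_iUnion.2 ?_
      by_cases hz : z ∈ S 0
      · rcases hz with hz | hz
        · obtain ⟨k, hk⟩ := exists_nat_one_div_lt (show 0 < height z.1 from hz)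
          exact ⟨k, Or.inl (Or.inl hk)⟩
        · obtain ⟨k, hk⟩ := exists_nat_one_div_lt (show 0 < height z.2 from hz)
          exact ⟨k, Or.inl (Or.inr hk)⟩
      · exact ⟨0, Or.inr hz⟩
  have hr1 : ∀ s, 0 ≤ s → γ.restrict (S 0) {z | s < height z.1} = m (Set.Ioi s) := fun s hs => by
    rw [Measure.restrict_apply (hms1 s), ← h1 s hs, Set.inter_eq_left.2]
    exact fun z hz => Or.inl (hs.trans_lt hz)
  have hr2 : ∀ s, 0 ≤ s → γ.restrict (S 0) {z | s < height z.2} = n (Set.Ioi s) := fun s hs => by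
    rw [Measure.restrict_apply (hms2 s), ← h2 s hs, Set.inter_eq_left.2]
    exact fun z hz => Or.inr (hs.trans_lt hz)
  refine (lintegral_quantile_le hp hm hn (γ.restrict (S 0)) (f := fun z => height z.1)
    (g := fun z => height z.2) (by fun_prop) (by fun_prop) hr1 hr2).trans ?_
  refine (lintegral_mono fun z => ?_).trans (lintegral_mono' Measure.restrict_le_self le_rfl)
  rw [edist_dist]
  exact ENNReal.rpow_le_rpow (ENNReal.ofReal_le_ofReal (abs_height_sub_le _ _)) (by linarith)

/-- The Figalli-Gigli distance of two measures on a ray is the `L^p` distance of their quantile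
functions. -/
theorem FG_rpow_map_rayPoint {p : ℝ} (hp : 1 ≤ p) {m n : Measure ℝ}
    (hm : HasFiniteTails m) (hn : HasFiniteTails n) (t : ℝ) :
    FG p ((m.restrict (Set.Ioi 0)).map (rayPoint t)) ((n.restrict (Set.Ioi 0)).map (rayPoint t)) ^ p =
      ∫⁻ u in Set.Ioi 0, ENNReal.ofReal |quantile m u - quantile n u| ^ p := by
  rw [FG, ← ENNReal.rpow_mul, one_div_mul_cancel (by linarith), ENNReal.rpow_one]
  refine le_antisymm (iInf₂_le_of_le _ (quantilePlan_mem_Adm hm hn t) (le_of_eq ?_))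
    (le_iInf₂ fun γ hγ => lintegral_quantile_le_of_mem_Adm hp hm hn t hγ)
  rw [quantilePlan, lintegral_map (by fun_prop)
    ((measurable_rayPoint_quantile t m).prodMk (measurable_rayPoint_quantile t n))]
  simp_rw [edist_dist, dist_rayPoint]

/-! ### Slices and their moments -/

/-- The points of the plane whose projection with parameter `t` is not collapsed. -/
def strip (t : ℝ) : Set Plane := {z | z 0 ≤ t ∧ t ≤ z 1}

/-- The distribution of the height under the slice of a measure. -/
noncomputable def sliceHeights (μ : Measure Plane) (t : ℝ) : Measure ℝ :=
  ((normalized μ).restrict (strip t)).map height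

theorem measurableSet_strip (t : ℝ) : MeasurableSet (strip t) := by
  rw [strip, Set.ofPred_and]
  exact (measurableSet_le (by fun_prop) measurable_const).inter
    (measurableSet_le measurable_const (by fun_prop))

theorem measurableSet_strip_prod : MeasurableSet {q : ℝ × Plane | q.2 ∈ strip q.1} := by
  have : {q : ℝ × Plane | q.2 ∈ strip q.1} = {q | q.2 0 ≤ q.1} ∩ {q | q.1 ≤ q.2 1} := rfl
  rw [this]
  exact (measurableSet_le (by fun_prop) (by fun_prop)).inter
    (measurableSet_le (by fun_prop) (by fun_prop))

theorem proj_of_mem_strip {t : ℝ} {z : Plane} (hz : z ∈ strip t) :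
    proj t z = rayPoint t (height z) := by
  have h : √2 * √2 = 2 := Real.mul_self_sqrt (by norm_num)
  have e : height z / √2 = (z 1 - z 0) / 2 := by rw [height, div_div, h]
  rw [rayPoint, e]
  exact if_pos hz

theorem proj_notMem_Omega {t : ℝ} {z : Plane} (hz : z ∉ strip t) : proj t z ∉ Omega := by
  have h : proj t z = !₂[t, t] := if_neg hz
  rw [h]
  simp [Omega]

theorem ae_normalized_mem_Omega {μ : Measure Plane} (hμ : μ Omegaᶜ = 0) :
    ∀ᵐ z ∂normalized μ, z ∈ Omega :=
  (withDensity_absolutelyContinuous μ _).ae_le (show ∀ᵐ z ∂μ, z ∈ Omega from hμ)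

/-- Inside the strip the projection preserves height; outside, it lands on the diagonal and is
removed by the restriction to `Omega`. -/
theorem slice_eq_map_rayPoint {μ : Measure Plane} (hμ : μ Omegaᶜ = 0) (t : ℝ) :
    slice t μ = ((sliceHeights μ t).restrict (Set.Ioi 0)).map (rayPoint t) := by
  have hr : Measurable (rayPoint t) := (continuous_rayPoint t).measurable
  have hh : Measurable height := continuous_height.measurable
  ext A hA
  rw [slice, Measure.restrict_apply hA,
    Measure.map_apply (measurable_proj t) (hA.inter measurableSet_Omega), Measure.map_apply hr hA,
    Measure.restrict_apply (hr hA), sliceHeights,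
    Measure.map_apply hh ((hr hA).inter measurableSet_Ioi),
    Measure.restrict_apply (hh ((hr hA).inter measurableSet_Ioi))]
  refine measure_congr ?_
  filter_upwards [ae_normalized_mem_Omega hμ] with z hz
  refine propext ?_
  change proj t z ∈ A ∩ Omega ↔ (rayPoint t (height z) ∈ A ∧ 0 < height z) ∧ z ∈ strip t
  have hz0 := mem_Omega_iff.1 hz
  by_cases hs : z ∈ strip t
  · simp [proj_of_mem_strip hs, mem_Omega_iff, hz0, hs]
  · simp only [hs, and_false, iff_false]
    exact fun h => proj_notMem_Omega hs h.2

theorem restrict_Omega_eq {μ : Measure Plane} (hμ : μ Omegaᶜ = 0) : μ.restrict Omega = μ :=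
  Measure.restrict_eq_self_of_ae_mem hμ

theorem measurable_distDiag : Measurable distDiag := measurable_infEDist

theorem lintegral_distDiag_rpow_lt_top {p : ℝ} (hp : 0 < p) {μ : Measure Plane}
    (hμ : μ ∈ PersMeasures p) : ∫⁻ z, distDiag z ^ p ∂μ < ∞ := by
  have h := hμ.2
  rwa [Pers, ENNReal.rpow_lt_top_iff_of_pos (by positivity), restrict_Omega_eq hμ.1.1] at h

/-- Weighting by `distDiag ^ p` gives a finite measure, and the weight is almost everywhere positive
and finite, so it can be divided out. Tonelli over the slices relies on this. -/
theorem sFinite_of_mem_PersMeasures {p : ℝ} (hp : 0 < p) {μ : Measure Plane}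
    (hμ : μ ∈ PersMeasures p) : SFinite μ := by
  have hm : Measurable fun z => distDiag z ^ p := measurable_distDiag.pow_const p
  have hfin : IsFiniteMeasure (μ.withDensity fun z => distDiag z ^ p) :=
    isFiniteMeasure_withDensity (lintegral_distDiag_rpow_lt_top hp hμ).ne
  have hΩ : ∀ᵐ z ∂μ, z ∈ Omega := hμ.1.1
  rw [← withDensity_inv_same (μ := μ) hm]
  · infer_instance
  · filter_upwards [hΩ] with z hz
    rw [distDiag_eq (mem_OmegaBar_iff.2 (mem_Omega_iff.1 hz).le)]
    simp [ENNReal.rpow_eq_zero_iff, hp, mem_Omega_iff.1 hz]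
  · filter_upwards [hΩ] with z hz
    rw [distDiag_eq (mem_OmegaBar_iff.2 (mem_Omega_iff.1 hz).le)]
    exact ENNReal.rpow_ne_top_of_nonneg hp.le ENNReal.ofReal_ne_top

theorem sFinite_normalized {p : ℝ} (hp : 0 < p) {μ : Measure Plane}
    (hμ : μ ∈ PersMeasures p) : SFinite (normalized μ) := by
  have := sFinite_of_mem_PersMeasures hp hμ
  unfold normalized
  infer_instance

theorem measurable_sliceHeights_Ioi (μ : Measure Plane) [SFinite (normalized μ)] (s : ℝ) :
    Measurable fun t => sliceHeights μ t (Set.Ioi s) := by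
  have hS : MeasurableSet ({q : ℝ × Plane | s < height q.2} ∩ {q | q.2 ∈ strip q.1}) :=
    (measurableSet_lt measurable_const (by fun_prop)).inter measurableSet_strip_prod
  have h := measurable_measure_prodMk_left (ν := normalized μ) hS
  convert h using 2 with t
  rw [sliceHeights, Measure.map_apply continuous_height.measurable measurableSet_Ioi,
    Measure.restrict_apply (continuous_height.measurable measurableSet_Ioi)]
  rfl

theorem lintegral_strip (z : Plane) (c : ℝ≥0∞) :
    ∫⁻ t, (strip t).indicator (fun _ => c) z = c * ENNReal.ofReal (z 1 - z 0) := by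
  have : (fun t => (strip t).indicator (fun _ => c) z) =
      (Set.Icc (z 0) (z 1)).indicator fun _ => c := by
    ext t
    by_cases h : z ∈ strip t
    · rw [Set.indicator_of_mem h, Set.indicator_of_mem (Set.mem_Icc.2 h)]
    · rw [Set.indicator_of_notMem h, Set.indicator_of_notMem fun h' => h (Set.mem_Icc.1 h')]
  rw [this, lintegral_indicator measurableSet_Icc, setLIntegral_const, Real.volume_Icc]

/-- The `p`-th moments of the slices integrate to a multiple of the `p`-persistence. -/
theorem lintegral_lintegral_sliceHeights {p : ℝ} (hp : 0 < p) {μ : Measure Plane}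
    (hμ : μ ∈ PersMeasures p) :
    ∫⁻ t, ∫⁻ s, ENNReal.ofReal s ^ p ∂sliceHeights μ t =
      ENNReal.ofReal √2 * ∫⁻ z, distDiag z ^ p ∂μ := by
  have := sFinite_normalized hp hμ
  have h1 : ∀ t, ∫⁻ s, ENNReal.ofReal s ^ p ∂sliceHeights μ t =
      ∫⁻ z, (strip t).indicator (fun _ => ENNReal.ofReal (height z) ^ p) z ∂normalized μ := by
    intro t
    rw [sliceHeights, lintegral_map (by fun_prop) continuous_height.measurable,
      ← lintegral_indicator (measurableSet_strip t)]
    rfl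
  have hm : Measurable fun q : ℝ × Plane =>
      (strip q.1).indicator (fun _ => ENNReal.ofReal (height q.2) ^ p) q.2 := by
    have : Measurable fun q : ℝ × Plane => ENNReal.ofReal (height q.2) ^ p := by fun_prop
    exact this.indicator measurableSet_strip_prod
  simp_rw [h1]
  rw [lintegral_lintegral_swap hm.aemeasurable]
  simp_rw [lintegral_strip]
  rw [normalized, lintegral_withDensity_eq_lintegral_mul _ (f := fun z => (distDiag z)⁻¹)
      measurable_distDiag.inv (by fun_prop),
    ← lintegral_const_mul _ (measurable_distDiag.pow_const p)]
  refine lintegral_congr_ae ?_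
  have hΩ : ∀ᵐ z ∂μ, z ∈ Omega := hμ.1.1
  filter_upwards [hΩ] with z hz
  have hz0 := mem_Omega_iff.1 hz
  -- The point `z` is seen by slices of total length `√2 * height z`; the normalization `1 /
  -- distDiag` cancels this extra factor of height.
  have e : z 1 - z 0 = √2 * height z := by
    have : √2 ≠ 0 := by positivity
    rw [height]
    field_simp
  have hne : ENNReal.ofReal (height z) ≠ 0 := by simpa using hz0
  rw [Pi.mul_apply, distDiag_eq (mem_OmegaBar_iff.2 hz0.le), e,
    ENNReal.ofReal_mul (Real.sqrt_nonneg 2)]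
  calc _ = (ENNReal.ofReal (height z))⁻¹ * ENNReal.ofReal (height z) *
        (ENNReal.ofReal √2 * ENNReal.ofReal (height z) ^ p) := by ring
    _ = _ := by rw [ENNReal.inv_mul_cancel hne ENNReal.ofReal_ne_top, one_mul]

theorem hasFiniteTails_of_lintegral_lt_top {p : ℝ} (hp : 0 < p) {m : Measure ℝ}
    (hm : ∫⁻ s, ENNReal.ofReal s ^ p ∂m < ∞) : HasFiniteTails m := by
  intro s hs
  have hpos : ENNReal.ofReal s ^ p ≠ 0 := by simp [ENNReal.rpow_eq_zero_iff, hp, hs]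
  have h := mul_meas_ge_le_lintegral (μ := m) (f := fun s => ENNReal.ofReal s ^ p) (by fun_prop)
    (ENNReal.ofReal s ^ p)
  have h2 : m {x | ENNReal.ofReal s ^ p ≤ ENNReal.ofReal x ^ p} < ∞ :=
    ENNReal.lt_top_of_mul_ne_top_right (h.trans_lt hm).ne hpos
  refine (measure_mono fun x hx => ?_).trans_lt h2
  exact ENNReal.rpow_le_rpow (ENNReal.ofReal_le_ofReal (le_of_lt hx)) hp.le

theorem setLIntegral_Ioi_ofReal_rpow {p : ℝ} (hp : 0 < p) (m : Measure ℝ) :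
    ∫⁻ s in Set.Ioi 0, ENNReal.ofReal s ^ p ∂m = ∫⁻ s, ENNReal.ofReal s ^ p ∂m := by
  rw [← lintegral_indicator measurableSet_Ioi]
  refine lintegral_congr fun s => ?_
  by_cases hs : 0 < s
  · rw [Set.indicator_of_mem (Set.mem_Ioi.2 hs)]
  · rw [Set.indicator_of_notMem (by simpa using hs), ENNReal.ofReal_of_nonpos (not_lt.1 hs),
      ENNReal.zero_rpow_of_pos hp]

theorem lintegral_quantile_rpow {p : ℝ} (hp : 0 < p) {m : Measure ℝ} (hm : HasFiniteTails m) :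
    ∫⁻ u in Set.Ioi 0, ENNReal.ofReal (quantile m u) ^ p = ∫⁻ s, ENNReal.ofReal s ^ p ∂m := by
  rw [← setLIntegral_Ioi_ofReal_rpow hp m, ← map_quantile_restrict hm,
    setLIntegral_Ioi_ofReal_rpow hp, lintegral_map (by fun_prop) (measurable_quantile m)]

theorem ae_hasFiniteTails_sliceHeights {p : ℝ} (hp : 0 < p) {μ : Measure Plane}
    (hμ : μ ∈ PersMeasures p) : ∀ᵐ t, HasFiniteTails (sliceHeights μ t) := by
  have := sFinite_normalized hp hμ
  have hfin : ∫⁻ t, ∫⁻ s, ENNReal.ofReal s ^ p ∂sliceHeights μ t ≠ ∞ := by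
    rw [lintegral_lintegral_sliceHeights hp hμ]
    exact ENNReal.mul_ne_top ENNReal.ofReal_ne_top (lintegral_distDiag_rpow_lt_top hp hμ).ne
  have hm : Measurable fun t => ∫⁻ s, ENNReal.ofReal s ^ p ∂sliceHeights μ t := by
    have h : Measurable fun q : ℝ × Plane =>
        (strip q.1).indicator (fun _ => ENNReal.ofReal (height q.2) ^ p) q.2 := by
      have : Measurable fun q : ℝ × Plane => ENNReal.ofReal (height q.2) ^ p := by fun_prop
      exact this.indicator measurableSet_strip_prod
    convert h.lintegral_prod_right' (ν := normalized μ) using 2 with t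
    rw [sliceHeights, lintegral_map (by fun_prop) continuous_height.measurable,
      ← lintegral_indicator (measurableSet_strip t)]
    rfl
  filter_upwards [ae_lt_top hm hfin] with t ht
  exact hasFiniteTails_of_lintegral_lt_top hp ht

/-! ### The embedding into `L^p` and the conclusion -/

/-- Lebesgue measure on the product of the line of slices and the half-line of levels. -/
noncomputable def levelMeasure : Measure (ℝ × ℝ) := volume.prod (volume.restrict (Set.Ioi 0))

/-- The quantile functions of all slices of a measure. -/
noncomputable def sliceQuantile (μ : Measure Plane) (z : ℝ × ℝ) : ℝ :=
  quantile (sliceHeights μ z.1) z.2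

theorem measurable_sliceQuantile {p : ℝ} (hp : 0 < p) {μ : Measure Plane}
    (hμ : μ ∈ PersMeasures p) : Measurable (sliceQuantile μ) := by
  have := sFinite_normalized hp hμ
  exact measurable_quantile_prod (measurable_sliceHeights_Ioi μ)

theorem lintegral_sliceQuantile_lt_top {p : ℝ} (hp : 0 < p) {μ : Measure Plane}
    (hμ : μ ∈ PersMeasures p) :
    ∫⁻ z, ENNReal.ofReal (sliceQuantile μ z) ^ p ∂levelMeasure < ∞ := by
  have hm := measurable_sliceQuantile hp hμ
  have h : ∫⁻ z, ENNReal.ofReal (sliceQuantile μ z) ^ p ∂levelMeasure =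
      ∫⁻ t, ∫⁻ s, ENNReal.ofReal s ^ p ∂sliceHeights μ t := by
    rw [levelMeasure, lintegral_prod _ (by fun_prop)]
    refine lintegral_congr_ae ?_
    filter_upwards [ae_hasFiniteTails_sliceHeights hp hμ] with t ht
    rw [← lintegral_quantile_rpow hp ht]
    simp only [sliceQuantile]
  rw [h, lintegral_lintegral_sliceHeights hp hμ]
  exact ENNReal.mul_lt_top ENNReal.ofReal_lt_top (lintegral_distDiag_rpow_lt_top hp hμ)

theorem ae_FG_slice_rpow_eq {p : ℝ} (hp : 1 ≤ p) {μ ν : Measure Plane}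
    (hμ : μ ∈ PersMeasures p) (hν : ν ∈ PersMeasures p) :
    ∀ᵐ t, FG p (slice t μ) (slice t ν) ^ p = ∫⁻ u in Set.Ioi 0,
      ENNReal.ofReal |sliceQuantile μ (t, u) - sliceQuantile ν (t, u)| ^ p := by
  have hp0 : 0 < p := by linarith
  filter_upwards [ae_hasFiniteTails_sliceHeights hp0 hμ, ae_hasFiniteTails_sliceHeights hp0 hν]
    with t h1 h2
  rw [slice_eq_map_rayPoint hμ.1.1, slice_eq_map_rayPoint hν.1.1, FG_rpow_map_rayPoint hp h1 h2]
  rfl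

/-- The quantile formula is measurable in `t` by Tonelli, but is established only for slices with
finite tails, hence almost everywhere. -/
theorem aemeasurable_FG_slice_rpow {p : ℝ} (hp : 1 ≤ p) {μ ν : Measure Plane}
    (hμ : μ ∈ PersMeasures p) (hν : ν ∈ PersMeasures p) :
    AEMeasurable fun t => FG p (slice t μ) (slice t ν) ^ p := by
  have h1 := measurable_sliceQuantile (by linarith) hμ
  have h2 := measurable_sliceQuantile (by linarith) hν
  have hm : Measurable fun z : ℝ × ℝ =>
      ENNReal.ofReal |sliceQuantile μ z - sliceQuantile ν z| ^ p := by fun_prop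
  exact ⟨_, hm.lintegral_prod_right', ae_FG_slice_rpow_eq hp hμ hν⟩

theorem lintegral_FG_slice_rpow {p : ℝ} (hp : 1 ≤ p) {μ ν : Measure Plane}
    (hμ : μ ∈ PersMeasures p) (hν : ν ∈ PersMeasures p) :
    ∫⁻ t, FG p (slice t μ) (slice t ν) ^ p =
      ∫⁻ z, ENNReal.ofReal |sliceQuantile μ z - sliceQuantile ν z| ^ p ∂levelMeasure := by
  have h1 := measurable_sliceQuantile (by linarith) hμ
  have h2 := measurable_sliceQuantile (by linarith) hν
  rw [levelMeasure, lintegral_prod _ (by fun_prop)]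
  exact lintegral_congr_ae (ae_FG_slice_rpow_eq hp hμ hν)

/-- Quantiles are nonnegative, so `|x - y| ^ p ≤ x ^ p + y ^ p` pointwise. -/
theorem lintegral_sliceQuantile_sub_lt_top {p : ℝ} (hp : 1 ≤ p) {μ ν : Measure Plane}
    (hμ : μ ∈ PersMeasures p) (hν : ν ∈ PersMeasures p) :
    ∫⁻ z, ENNReal.ofReal |sliceQuantile μ z - sliceQuantile ν z| ^ p ∂levelMeasure < ∞ := by
  have hp0 : 0 < p := by linarith
  have h1 := measurable_sliceQuantile hp0 hμ
  refine lt_of_le_of_lt (lintegral_mono fun z => ?_) ((lintegral_add_left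
    (f := fun z => ENNReal.ofReal (sliceQuantile μ z) ^ p) (by fun_prop)
    (fun z => ENNReal.ofReal (sliceQuantile ν z) ^ p)).trans_lt (ENNReal.add_lt_top.2
      ⟨lintegral_sliceQuantile_lt_top hp0 hμ, lintegral_sliceQuantile_lt_top hp0 hν⟩))
  have hμ0 : 0 ≤ sliceQuantile μ z := quantile_nonneg _ _
  have hν0 : 0 ≤ sliceQuantile ν z := quantile_nonneg _ _
  rcases le_total (sliceQuantile μ z) (sliceQuantile ν z) with h | h
  · refine le_add_left (ENNReal.rpow_le_rpow (ENNReal.ofReal_le_ofReal ?_) hp0.le)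
    rw [abs_sub_comm, abs_of_nonneg (by linarith)]
    linarith
  · refine le_add_right (ENNReal.rpow_le_rpow (ENNReal.ofReal_le_ofReal ?_) hp0.le)
    rw [abs_of_nonneg (by linarith)]
    linarith

theorem SFG_lt_top {p : ℝ} (hp : 1 ≤ p) {μ ν : Measure Plane}
    (hμ : μ ∈ PersMeasures p) (hν : ν ∈ PersMeasures p) : SFG p μ ν < ∞ := by
  rw [SFG, lintegral_FG_slice_rpow hp hμ hν]
  exact ENNReal.mul_lt_top ENNReal.ofReal_lt_top (ENNReal.rpow_lt_top_of_nonneg (by positivity)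
    (lintegral_sliceQuantile_sub_lt_top hp hμ hν).ne)

theorem integrable_abs_sliceQuantile_sub_rpow {p : ℝ} (hp : 1 ≤ p) {μ ν : Measure Plane}
    (hμ : μ ∈ PersMeasures p) (hν : ν ∈ PersMeasures p) :
    Integrable (fun z => |sliceQuantile μ z - sliceQuantile ν z| ^ p) levelMeasure := by
  have h1 := measurable_sliceQuantile (by linarith) hμ
  have h2 := measurable_sliceQuantile (by linarith) hν
  refine (lintegral_ofReal_ne_top_iff_integrable
    (Measurable.pow_const (by fun_prop) p).aestronglyMeasurable
    (ae_of_all _ fun z => Real.rpow_nonneg (abs_nonneg _) _)).1 ?_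
  simp_rw [← ENNReal.ofReal_rpow_of_nonneg (abs_nonneg _) (show 0 ≤ p by linarith)]
  exact (lintegral_sliceQuantile_sub_lt_top hp hμ hν).ne

theorem sfgPow_eq {p : ℝ} (hp : 1 ≤ p) (μ ν : PersMeasures p) :
    sfgPow p μ ν = (1 / √2) ^ p *
      ∫ z, |sliceQuantile μ z - sliceQuantile ν z| ^ p ∂levelMeasure := by
  have h1 := measurable_sliceQuantile (by linarith) μ.2
  have h2 := measurable_sliceQuantile (by linarith) ν.2
  rw [sfgPow, SFG, lintegral_FG_slice_rpow hp μ.2 ν.2, ENNReal.toReal_mul,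
    ENNReal.toReal_ofReal (by positivity), ← ENNReal.toReal_rpow,
    Real.mul_rpow (by positivity) (by positivity), ← Real.rpow_mul ENNReal.toReal_nonneg,
    one_div_mul_cancel (by linarith), Real.rpow_one, integral_eq_lintegral_of_nonneg_ae
      (ae_of_all _ fun z => Real.rpow_nonneg (abs_nonneg _) _)
      (Measurable.pow_const (by fun_prop) p).aestronglyMeasurable]
  simp_rw [← ENNReal.ofReal_rpow_of_nonneg (abs_nonneg _) (show 0 ≤ p by linarith)]

theorem isCND_sfgPow {p : ℝ} (hp₁ : 1 ≤ p) (hp₂ : p ≤ 2) : IsCND (sfgPow p) := by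
  intro n x a ha
  have hint : ∀ i j, Integrable (fun z => a i * a j *
      |sliceQuantile (x i) z - sliceQuantile (x j) z| ^ p) levelMeasure := fun i j =>
    (integrable_abs_sliceQuantile_sub_rpow hp₁ (x i).2 (x j).2).const_mul _
  have h : ∑ i, ∑ j, a i * a j * sfgPow p (x i) (x j) = (1 / √2) ^ p *
      ∫ z, ∑ i, ∑ j, a i * a j *
        |sliceQuantile (x i) z - sliceQuantile (x j) z| ^ p ∂levelMeasure := by
    rw [integral_finsetSum _ fun i _ => integrable_finsetSum _ fun j _ => hint i j, Finset.mul_sum]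
    refine Finset.sum_congr rfl fun i _ => ?_
    rw [integral_finsetSum _ fun j _ => hint i j, Finset.mul_sum]
    refine Finset.sum_congr rfl fun j _ => ?_
    rw [integral_const_mul, sfgPow_eq hp₁]
    ring
  rw [h]
  refine mul_nonpos_of_nonneg_of_nonpos (by positivity) (integral_nonpos fun z => ?_)
  exact sum_mul_abs_sub_rpow_nonpos (by linarith) hp₂ a (fun i => sliceQuantile (x i) z) ha

theorem isPSDKernel_exp_neg_sfgPow {p : ℝ} (hp₁ : 1 ≤ p) (hp₂ : p ≤ 2) (σ : ℝ) :
    IsPSDKernel fun μ ν : PersMeasures p => Real.exp (-(sfgPow p μ ν / σ ^ 2)) := by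
  refine IsCND.isPSDKernel_exp_neg (f := fun μ ν => sfgPow p μ ν / σ ^ 2) ?_ ?_ ?_
  · intro n x a ha
    simp_rw [← mul_div_assoc, ← Finset.sum_div]
    exact div_nonpos_of_nonpos_of_nonneg (isCND_sfgPow hp₁ hp₂ n x a ha) (sq_nonneg σ)
  · intro μ ν
    simp_rw [sfgPow_eq hp₁, abs_sub_comm]
  · intro μ
    simp [sfgPow_eq hp₁, Real.zero_rpow (show p ≠ 0 by linarith)]

end Persistence

theorem mainTheorem5 (p : ℝ) (hp₁ : 1 ≤ p) (hp₂ : p ≤ 2) :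
    (∀ μ ∈ Persistence.PersMeasures p, ∀ ν ∈ Persistence.PersMeasures p,
      AEMeasurable (fun t : ℝ =>
        Persistence.FG p (Persistence.slice t μ) (Persistence.slice t ν) ^ p) ∧
      Persistence.SFG p μ ν < ∞) ∧
    Persistence.IsCND (Persistence.sfgPow p) ∧
    ∀ σ : ℝ, 0 < σ → Persistence.IsPSDKernel fun μ ν : Persistence.PersMeasures p =>
      Real.exp (-(Persistence.sfgPow p μ ν / σ ^ 2)) :=
  ⟨fun _ hμ _ hν => ⟨Persistence.aemeasurable_FG_slice_rpow hp₁ hμ hν,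
      Persistence.SFG_lt_top hp₁ hμ hν⟩,
    Persistence.isCND_sfgPow hp₁ hp₂,
    fun σ _ => Persistence.isPSDKernel_exp_neg_sfgPow hp₁ hp₂ σ⟩
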